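/- All graphs are finite and simple. The square $G^2$ of a graph $G$ is obtained from $G$ by adding an edge between each pair of vertices at distance $2$ in $G$. A graph is $2$-degenerate if each of its nonempty subgraphs has a vertex of degree at most $2$ in that subgraph, and $\mathrm{mad}(G)=\max_{H\subseteq G}2|E(H)|/|V(H)|$, the maximum being over subgraphs $H$ with at least one vertex. For a positive integer $D$, let $f(D)$ be the maximum size of a clique in $G^2$ over all $2$-degenerate graphs $G$ with maximum degree $\Delta(G)\le D$, and let $g(D)$ be the maximum size of a clique in $G^2$ over all graphs $G$ with $\mathrm{mad}(G)<4$ and $\Delta(G)\le D$. Theorem. For every positive integer $D$, the maxima $f(D)$ and $g(D)$ exist, and some $2$-degenerate graph $G$ with $\Delta(G)\le D$ has a clique $S'$ in $G^2$ with $|S'|\ge g(D)-460$. Hence $0\le g(D)-f(D)\le 460$ for every positive integer $D$; in particular, $g(D)-f(D)$ is bounded by a constant. -/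

import Mathlib

namespace SquareClique

/-- The square of a graph: an edge is added between each pair of vertices at distance two. -/
def square {V : Type*} (G : SimpleGraph V) : SimpleGraph V where
  Adj u v := G.Adj u v ∨ G.dist u v = 2
  symm := ⟨fun u v h => by
    rcases h with h | h
    · exact Or.inl h.symm
    · exact Or.inr (by rw [SimpleGraph.dist_comm]; exact h)⟩
  loopless := ⟨fun u h => by
    rcases h with h | h
    · exact G.loopless.irrefl u h
    · rw [SimpleGraph.dist_self] at h
      omega⟩

/-- A graph is `k`-degenerate if each of its (nonempty) subgraphs has a vertex of degree
at most `k` in that subgraph. -/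
def IsDegenerate {V : Type*} (k : ℕ) (G : SimpleGraph V) : Prop :=
  ∀ H : G.Subgraph, H.verts.Nonempty → ∃ v ∈ H.verts, (H.neighborSet v).encard ≤ k

/-- The maximum average degree of a finite graph: the maximum of `2|E(H)|/|V(H)|` over the
subgraphs `H`. The subgraph without vertices contributes `0`, so it never affects the maximum
for a graph that has a vertex. -/
noncomputable def mad {V : Type*} [Finite V] (G : SimpleGraph V) : ℝ :=
  ⨆ H : G.Subgraph, 2 * (H.edgeSet.ncard : ℝ) / (H.verts.ncard : ℝ)

/-- The supremum defining `mad` is attained, and it is an upper bound. -/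
theorem isGreatest_mad {V : Type*} [Finite V] (G : SimpleGraph V) :
    IsGreatest (Set.range fun H : G.Subgraph =>
      2 * (H.edgeSet.ncard : ℝ) / (H.verts.ncard : ℝ)) (mad G) :=
  ⟨Set.Nonempty.csSup_mem (Set.range_nonempty _) (Set.finite_range _),
    fun _ hx => le_csSup (Set.finite_range _).bddAbove hx⟩

/-- The sizes of cliques in squares of finite 2-degenerate graphs with maximum degree at
most `D`. -/
def degenerateSizes (D : ℕ) : Set ℕ :=
  {n | ∃ (V : Type) (_ : Fintype V) (G : SimpleGraph V) (_ : DecidableRel G.Adj),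
    IsDegenerate 2 G ∧ G.maxDegree ≤ D ∧ ∃ S : Finset V, (square G).IsNClique n S}

/-- The sizes of cliques in squares of finite graphs with maximum average degree less than `4`
and maximum degree at most `D`. -/
def madSizes (D : ℕ) : Set ℕ :=
  {n | ∃ (V : Type) (_ : Fintype V) (G : SimpleGraph V) (_ : DecidableRel G.Adj),
    mad G < 4 ∧ G.maxDegree ≤ D ∧ ∃ S : Finset V, (square G).IsNClique n S}

/-- The maximum size of a clique in the square of a 2-degenerate graph with maximum degree at
most `D`. -/
noncomputable def f (D : ℕ) : ℕ := sSup (degenerateSizes D)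

/-- The maximum size of a clique in the square of a graph with maximum average degree less
than `4` and maximum degree at most `D`. -/
noncomputable def g (D : ℕ) : ℕ := sSup (madSizes D)

end SquareClique

/-! Let `S` be a clique in the square of `G`, where mad(G) < 4 and Δ(G) ≤ D. A blown-up pentagon
gives f(D) ≥ 5D/2 − O(1), so `S` may be assumed larger than 5D/2 by a big constant.

A vertex of `S` reaches the rest of `S` through at most D neighbours, so the excesses of these
neighbours sum to at least about 3D/2. Each excess is at most D, so essentially two neighbours must
have many neighbours in `S`. On the other hand, mad(G) < 4 bounds the edges at `S`: shared out as
charges, they give a vertex of `S` less than 2 on average (`sum_charge_lt`).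

Discard the few vertices with at least D/6 neighbours in `S`. Each remaining vertex receives at
least 2 − 24/D, and at least 7/3 − 24/D if three of its neighbours have positive charge
(`le_sum_charge`). Hence only boundedly many are of the latter kind (`card_crowded_le`). Discard
them too and keep only the edges at the surviving clique vertices: the clique survives, and the
graph is 2-degenerate (`touching_isDegenerate`). -/

namespace SquareClique

open Finset

/-! ### Counting in square cliques and the edge bound from mad -/

section Counting

variable {V : Type*} {G : SimpleGraph V}

theorem square_adj_iff {u v : V} :
    (square G).Adj u v ↔ u ≠ v ∧ (G.Adj u v ∨ ∃ w, G.Adj u w ∧ G.Adj w v) := by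
  constructor
  · intro h
    refine ⟨h.ne, ?_⟩
    rcases h with h | h
    · exact Or.inl h
    · right
      have hr : G.Reachable u v := by
        by_contra hn
        rw [SimpleGraph.dist_eq_zero_of_not_reachable hn] at h
        omega
      obtain ⟨p, hp⟩ := hr.exists_walk_length_eq_dist
      rw [h] at hp
      match p, hp with
      | .cons h1 (.cons h2 .nil), _ => exact ⟨_, h1, h2⟩
  · rintro ⟨hne, h⟩
    by_cases ha : G.Adj u v
    · exact Or.inl ha
    · obtain ⟨w, h1, h2⟩ := h.resolve_left ha
      right
      have hle : G.dist u v ≤ 2 := SimpleGraph.dist_le (.cons h1 (.cons h2 .nil))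
      have hr : G.Reachable u v := ⟨.cons h1 (.cons h2 .nil)⟩
      have h0 : G.dist u v ≠ 0 := fun h => hne (hr.dist_eq_zero_iff.1 h)
      have h1' : G.dist u v ≠ 1 := fun h => ha (SimpleGraph.dist_eq_one_iff_adj.1 h)
      omega

variable [DecidableRel G.Adj]

variable (G) in
/-- The number of neighbours of `v` in `A`. -/
def degIn (A : Finset V) (v : V) : ℕ := #{u ∈ A | G.Adj v u}

theorem degIn_mono {A B : Finset V} (h : A ⊆ B) (v : V) : degIn G A v ≤ degIn G B v :=
  card_le_card (filter_subset_filter _ h)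

theorem sum_sum_adj_eq {M : Type*} [Semiring M] [Fintype V] (A : Finset V) (F : V → M) :
    ∑ u ∈ A, ∑ w with G.Adj u w, F w = ∑ w, (degIn G A w : M) * F w := by
  simp_rw [sum_filter]
  rw [sum_comm]
  refine sum_congr rfl fun w _ => ?_
  rw [← sum_filter, sum_const, nsmul_eq_mul, degIn]
  simp_rw [G.adj_comm]

theorem sum_degIn_comm (A B : Finset V) : ∑ u ∈ A, degIn G B u = ∑ w ∈ B, degIn G A w := by
  simp_rw [degIn, card_filter]
  rw [sum_comm]
  simp_rw [G.adj_comm]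

theorem degIn_univ_eq_degree [Fintype V] (v : V) : degIn G univ v = G.degree v := by
  rw [degIn, ← SimpleGraph.card_neighborFinset_eq_degree, SimpleGraph.neighborFinset_eq_filter]

theorem degIn_le_of_maxDegree_le [Fintype V] {D : ℕ} (h : G.maxDegree ≤ D) (A : Finset V) (v : V) :
    degIn G A v ≤ D := by
  refine (degIn_mono (subset_univ A) v).trans ?_
  rw [degIn_univ_eq_degree]
  exact (G.degree_le_maxDegree v).trans h

variable [DecidableEq V]

variable (G) in
/-- A neighbour `w` of `u ∈ A` accounts for at most `1 + excess G A w` elements of `A` other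
than `u` that are `w` itself or neighbours of `w`. -/
def excess (A : Finset V) (w : V) : ℕ := if w ∈ A then degIn G A w - 1 else degIn G A w - 2

variable [Fintype V]

theorem card_le_sum_excess {A : Finset V} (hA : (square G).IsClique (A : Set V)) {u : V}
    (hu : u ∈ A) : #A ≤ 1 + ∑ w with G.Adj u w, (1 + excess G A w) := by
  have hsub : A.erase u ⊆ ({w | G.Adj u w} : Finset V).biUnion fun w =>
      if w ∈ A then insert w ({v ∈ A | G.Adj w v}.erase u) else {v ∈ A | G.Adj w v}.erase u := by
    intro v hv
    rw [mem_erase] at hv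
    obtain ⟨-, h⟩ := square_adj_iff.1 (hA hu hv.2 hv.1.symm)
    rw [mem_biUnion]
    rcases h with h | ⟨w, h1, h2⟩
    · exact ⟨v, by simpa using h, by simp [hv.2]⟩
    · refine ⟨w, by simpa using h1, ?_⟩
      split_ifs <;> simp [hv, h2]
  have hle := (card_le_card hsub).trans card_biUnion_le
  rw [card_erase_of_mem hu] at hle
  have hw : ∀ w ∈ ({w | G.Adj u w} : Finset V), #(if w ∈ A then
      insert w ({v ∈ A | G.Adj w v}.erase u) else {v ∈ A | G.Adj w v}.erase u) ≤
      1 + excess G A w := by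
    intro w hw
    have huw : u ∈ {v ∈ A | G.Adj w v} := by
      simpa [hu] using (by simpa using hw : G.Adj u w).symm
    have hc := card_erase_of_mem huw
    unfold excess degIn
    split_ifs
    · refine (card_insert_le _ _).trans ?_
      omega
    · omega
  have := hle.trans (sum_le_sum hw)
  omega

/-- A crude bound, needed only so that the suprema defining `f` and `g` are maxima. -/
theorem card_le_of_isClique_square {D : ℕ} (hD : G.maxDegree ≤ D) {A : Finset V}
    (hA : (square G).IsClique (A : Set V)) : #A ≤ 1 + D * (1 + D) := by
  rcases A.eq_empty_or_nonempty with rfl | ⟨u, hu⟩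
  · simp
  refine (card_le_sum_excess hA hu).trans ?_
  gcongr
  refine (sum_le_card_nsmul _ _ (1 + D) fun w _ => ?_).trans ?_
  · have := degIn_le_of_maxDegree_le hD A w
    unfold excess
    split_ifs <;> omega
  · rw [smul_eq_mul]
    gcongr
    exact degIn_le_of_maxDegree_le hD univ u

/-- The edge count that `mad G < 4` gives for the subgraph induced by `A ∪ T`. -/
theorem two_mul_sum_degIn_lt (hmad : mad G < 4) {A T : Finset V} (hA : A.Nonempty)
    (hAT : Disjoint A T) :
    2 * ∑ w ∈ T, degIn G A w + ∑ u ∈ A, degIn G A u < 4 * (#A + #T) := by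
  classical
  let H : G.Subgraph := (⊤ : G.Subgraph).induce ↑(A ∪ T)
  have hH : 2 * (H.edgeSet.ncard : ℝ) / (H.verts.ncard : ℝ) < 4 :=
    lt_of_le_of_lt ((isGreatest_mad G).2 ⟨H, rfl⟩) hmad
  have hv : H.verts.ncard = #A + #T := by
    rw [show H.verts = ↑(A ∪ T) from rfl, Set.ncard_coe_finset, card_union_of_disjoint hAT]
  have hApos : 0 < #A := hA.card_pos
  rw [hv, div_lt_iff₀ (by exact_mod_cast (by omega : 0 < #A + #T))] at hH
  have hE : 2 * H.edgeSet.ncard < 4 * (#A + #T) := by exact_mod_cast hH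
  have hsum : ∑ v, H.spanningCoe.degree v = 2 * H.edgeSet.ncard := by
    rw [SimpleGraph.sum_degrees_eq_twice_card_edges, ← Set.ncard_coe_finset,
      SimpleGraph.coe_edgeFinset, SimpleGraph.Subgraph.edgeSet_spanningCoe]
  have hdeg : ∀ v ∈ A ∪ T, H.spanningCoe.degree v = degIn G (A ∪ T) v := by
    intro v hv
    rw [← degIn_univ_eq_degree, degIn, degIn]
    congr 1
    ext w
    have : v ∈ A ∨ v ∈ T := by simpa using hv
    simp [H, this]
  have h1 : ∑ v ∈ A ∪ T, degIn G (A ∪ T) v ≤ 2 * H.edgeSet.ncard := by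
    rw [← hsum, ← sum_congr rfl hdeg]
    exact sum_le_sum_of_subset (subset_univ _)
  have h2 : ∀ v, degIn G (A ∪ T) v = degIn G A v + degIn G T v := by
    intro v
    unfold degIn
    rw [filter_union, card_union_of_disjoint (disjoint_filter_filter hAT)]
  rw [sum_union hAT] at h1
  simp_rw [h2, sum_add_distrib] at h1
  -- Edges between `A` and `T` are counted from both sides, hence the factor 2; edges inside `T` are
  -- dropped.
  have := sum_degIn_comm (G := G) A T
  omega

end Counting

/-! ### 2-degenerate graphs have mad < 4; existence of the maxima -/

section Degenerate

variable {V : Type*} {G : SimpleGraph V}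

/-- Deleting a vertex of degree at most 2 loses at most two edges, and a single vertex carries none.
-/
theorem IsDegenerate.ncard_edgeSet_lt [Finite V] (hG : IsDegenerate 2 G) (n : ℕ) :
    ∀ H : G.Subgraph, H.verts.ncard = n + 1 → H.edgeSet.ncard < 2 * (n + 1) := by
  induction n with
  | zero =>
    intro H hH
    obtain ⟨a, ha⟩ := Set.ncard_eq_one.1 hH
    have : H.edgeSet = ∅ := by
      refine Set.eq_empty_of_forall_notMem fun e => ?_
      induction e with | _ u v
      intro h
      have h : H.Adj u v := h
      have hu := H.edge_vert h
      have hv := H.edge_vert h.symm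
      rw [ha] at hu hv
      exact h.ne (hu.trans hv.symm)
    simp [this]
  | succ n ih =>
    intro H hH
    obtain ⟨v, hv, hd⟩ := hG H (Set.nonempty_of_ncard_ne_zero (by omega))
    have hd' : (H.neighborSet v).ncard ≤ 2 := by
      rw [← Set.Finite.cast_ncard_eq (Set.toFinite _)] at hd
      exact_mod_cast hd
    have h1 := ih (H.deleteVerts {v}) (by
      rw [SimpleGraph.Subgraph.deleteVerts_verts, Set.ncard_sdiff_singleton_of_mem hv, hH]
      omega)
    have hsub : H.edgeSet ⊆ (H.deleteVerts {v}).edgeSet ∪ (fun w => s(v, w)) '' H.neighborSet v := by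
      intro e
      induction e with | _ a b
      intro h
      have h : H.Adj a b := h
      by_cases hav : a = v
      · subst hav
        exact Or.inr ⟨b, h, rfl⟩
      by_cases hbv : b = v
      · subst hbv
        exact Or.inr ⟨a, h.symm, Sym2.eq_swap⟩
      · left
        simp [hav, hbv, h, H.edge_vert h, H.edge_vert h.symm]
    have h2 := (Set.ncard_le_ncard hsub (Set.toFinite _)).trans (Set.ncard_union_le _ _)
    have h3 := Set.ncard_image_le (f := fun w => s(v, w)) (Set.toFinite (H.neighborSet v))
    omega

theorem IsDegenerate.mad_lt_four [Finite V] (hG : IsDegenerate 2 G) : mad G < 4 := by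
  obtain ⟨H, hH⟩ := (isGreatest_mad G).1
  rw [← hH]
  dsimp only
  rcases Nat.eq_zero_or_pos H.verts.ncard with h | h
  · simp [h]
  · obtain ⟨n, hn⟩ := Nat.exists_eq_add_of_lt h
    have := hG.ncard_edgeSet_lt n H (by omega)
    rw [div_lt_iff₀ (by exact_mod_cast h)]
    have h2 : 2 * H.edgeSet.ncard < 4 * H.verts.ncard := by omega
    exact_mod_cast h2

theorem degenerateSizes_subset_madSizes (D : ℕ) : degenerateSizes D ⊆ madSizes D := by
  rintro n ⟨V, _, G, _, hG, h⟩
  exact ⟨V, _, G, _, hG.mad_lt_four, h⟩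

theorem zero_mem_degenerateSizes (D : ℕ) : 0 ∈ degenerateSizes D :=
  ⟨Empty, inferInstance, ⊥, inferInstance, fun _ ⟨v, _⟩ => v.elim,
    SimpleGraph.maxDegree_le_of_forall_degree_le _ _ fun v => v.elim, ∅, by
      simp [SimpleGraph.isNClique_iff]⟩

theorem bddAbove_madSizes (D : ℕ) : BddAbove (madSizes D) := by
  classical
  refine ⟨1 + D * (1 + D), ?_⟩
  rintro n ⟨V, _, G, _, -, hD, S, hS⟩
  rw [← hS.card_eq]
  exact card_le_of_isClique_square hD hS.isClique

theorem isGreatest_f (D : ℕ) : IsGreatest (degenerateSizes D) (f D) :=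
  have hb := (bddAbove_madSizes D).mono (degenerateSizes_subset_madSizes D)
  ⟨Nat.sSup_mem ⟨0, zero_mem_degenerateSizes D⟩ hb, fun _ h => le_csSup hb h⟩

theorem isGreatest_g (D : ℕ) : IsGreatest (madSizes D) (g D) :=
  ⟨Nat.sSup_mem ⟨0, degenerateSizes_subset_madSizes D (zero_mem_degenerateSizes D)⟩
    (bddAbove_madSizes D), fun _ h => le_csSup (bddAbove_madSizes D) h⟩

end Degenerate

/-! ### Lower bound for f: the blown-up pentagon -/

section PentagonConstruction

variable (m : ℕ)

/-- Vertices of a blown-up pentagon: five hubs, five groups of `m` vertices, and one connector for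
each pair of vertices in groups at distance two. -/
abbrev PentagonVertex := ZMod 5 ⊕ (ZMod 5 × Fin m) ⊕ (ZMod 5 × Fin m × Fin m)

/-- The group vertex `p` is joined to the hub or connector `q`. -/
def pentagonRel (p : ZMod 5 × Fin m) : PentagonVertex m → Prop
  | .inl i => i = p.1 ∨ i = p.1 + 1
  | .inr (.inl _) => False
  | .inr (.inr t) => (t.1, t.2.1) = p ∨ (t.1 + 2, t.2.2) = p

/-- The graph of the blown-up pentagon. -/
def pentagonGraph : SimpleGraph (PentagonVertex m) :=
  SimpleGraph.fromRel fun a b => ∃ p, a = .inr (.inl p) ∧ pentagonRel m p b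

variable {m}

theorem pentagonGraph_adj_group {p : ZMod 5 × Fin m} {b : PentagonVertex m} :
    (pentagonGraph m).Adj (.inr (.inl p)) b ↔ pentagonRel m p b := by
  obtain ⟨i, x⟩ := p
  rcases b with i | q | t <;> simp [pentagonGraph, pentagonRel]

theorem pentagonGraph_exists_group {a b : PentagonVertex m} (h : (pentagonGraph m).Adj a b) :
    ∃ p, a = .inr (.inl p) ∨ b = .inr (.inl p) := by
  obtain ⟨-, ⟨p, hp, -⟩ | ⟨p, hp, -⟩⟩ := (SimpleGraph.fromRel_adj _ _ _).1 h
  · exact ⟨p, Or.inl hp⟩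
  · exact ⟨p, Or.inr hp⟩

theorem pentagonGraph_neighbor_connector (t : ZMod 5 × Fin m × Fin m) (b : PentagonVertex m)
    (h : (pentagonGraph m).Adj (.inr (.inr t)) b) :
    b ∈ ({.inr (.inl (t.1, t.2.1)), .inr (.inl (t.1 + 2, t.2.2))} : Finset (PentagonVertex m)) := by
  obtain ⟨p, hp | rfl⟩ := pentagonGraph_exists_group h
  · simp at hp
  · have h := pentagonGraph_adj_group.1 h.symm
    rcases h with h | h <;> simp [← h]

theorem pentagonGraph_neighbor_hub (i : ZMod 5) (b : PentagonVertex m)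
    (h : (pentagonGraph m).Adj (.inl i) b) :
    b ∈ ({i, i - 1} ×ˢ univ : Finset (ZMod 5 × Fin m)).image (.inr ∘ .inl) := by
  obtain ⟨p, hp | rfl⟩ := pentagonGraph_exists_group h
  · simp at hp
  · have h := pentagonGraph_adj_group.1 h.symm
    rcases h with h | h <;> simp [h]

theorem pentagonGraph_neighbor_group (p : ZMod 5 × Fin m) (b : PentagonVertex m)
    (h : (pentagonGraph m).Adj (.inr (.inl p)) b) :
    b ∈ ({.inl p.1, .inl (p.1 + 1)} : Finset (PentagonVertex m)) ∪
      (univ.image (fun y : Fin m => (.inr (.inr (p.1, p.2, y)) : PentagonVertex m)) ∪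
       univ.image (fun x : Fin m => (.inr (.inr (p.1 - 2, x, p.2)) : PentagonVertex m))) := by
  rw [pentagonGraph_adj_group] at h
  rcases b with i | q | ⟨i, x, y⟩
  · rcases h with h | h <;> simp [h]
  · exact h.elim
  · rcases h with h | h <;> simp [← h]

/-- Connectors have at most two neighbours; without connectors a group vertex sees only two hubs;
hubs alone span no edge. -/
theorem pentagonGraph_isDegenerate : IsDegenerate 2 (pentagonGraph m) := by
  intro H hH
  by_cases hc : ∃ t, .inr (.inr t) ∈ H.verts
  · obtain ⟨t, ht⟩ := hc
    refine ⟨_, ht, ?_⟩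
    refine (Set.encard_le_encard fun b hb =>
      mem_coe.2 (pentagonGraph_neighbor_connector t b (H.adj_sub hb))).trans ?_
    rw [Set.encard_coe_eq_coe_finsetCard]
    exact_mod_cast card_le_two
  by_cases hg : ∃ p, .inr (.inl p) ∈ H.verts
  · obtain ⟨p, hp⟩ := hg
    refine ⟨_, hp, ?_⟩
    have hsub : H.neighborSet (.inr (.inl p)) ⊆
        (({.inl p.1, .inl (p.1 + 1)} : Finset (PentagonVertex m)) : Set _) := by
      intro b hb
      have h := pentagonGraph_adj_group.1 (H.adj_sub hb)
      rcases b with i | q | t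
      · rcases h with h | h <;> simp [h]
      · exact h.elim
      · exact (hc ⟨t, H.edge_vert (H.adj_symm hb)⟩).elim
    refine (Set.encard_le_encard hsub).trans ?_
    rw [Set.encard_coe_eq_coe_finsetCard]
    exact_mod_cast card_le_two
  · obtain ⟨v, hv⟩ := hH
    refine ⟨v, hv, ?_⟩
    have : H.neighborSet v = ∅ := by
      refine Set.eq_empty_of_forall_notMem fun b hb => hg ?_
      obtain ⟨p, rfl | rfl⟩ := pentagonGraph_exists_group (H.adj_sub hb)
      · exact ⟨p, hv⟩
      · exact ⟨p, H.edge_vert (H.adj_symm hb)⟩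
    simp [this]

theorem pentagonGraph_degree_le [DecidableRel (pentagonGraph m).Adj]
    (v : PentagonVertex m) : (pentagonGraph m).degree v ≤ 2 * m + 2 := by
  rw [← SimpleGraph.card_neighborFinset_eq_degree]
  rcases v with i | p | t
  · refine (card_le_card fun b hb => pentagonGraph_neighbor_hub i b (by simpa using hb)).trans ?_
    refine card_image_le.trans ?_
    rw [card_product, card_univ, Fintype.card_fin]
    have : #({i, i - 1} : Finset (ZMod 5)) ≤ 2 := card_le_two
    nlinarith
  · refine (card_le_card fun b hb => pentagonGraph_neighbor_group p b (by simpa using hb)).trans ?_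
    refine (card_union_le _ _).trans ?_
    have h1 : #({.inl p.1, .inl (p.1 + 1)} : Finset (PentagonVertex m)) ≤ 2 := card_le_two
    have h2 := card_union_le
      (univ.image (fun y : Fin m => (.inr (.inr (p.1, p.2, y)) : PentagonVertex m)))
      (univ.image (fun x : Fin m => (.inr (.inr (p.1 - 2, x, p.2)) : PentagonVertex m)))
    have h3 := card_image_le (s := univ)
      (f := fun y : Fin m => (.inr (.inr (p.1, p.2, y)) : PentagonVertex m))
    have h4 := card_image_le (s := univ)
      (f := fun x : Fin m => (.inr (.inr (p.1 - 2, x, p.2)) : PentagonVertex m))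
    rw [card_univ, Fintype.card_fin] at h3 h4
    omega
  · refine (card_le_card fun b hb => pentagonGraph_neighbor_connector t b (by simpa using hb)).trans ?_
    exact card_le_two.trans (by omega)

/-- Equal or consecutive groups share a hub; vertices in groups at distance two share their
connector. -/
theorem pentagonGraph_isClique :
    (square (pentagonGraph m)).IsClique
      (univ.map (Function.Embedding.inl.trans Function.Embedding.inr) :
        Finset (PentagonVertex m)) := by
  intro a ha b hb hab
  obtain ⟨p, rfl⟩ : ∃ p, .inr (.inl p) = a := by simpa using ha
  obtain ⟨q, rfl⟩ : ∃ q, .inr (.inl q) = b := by simpa using hb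
  refine square_adj_iff.2 ⟨hab, Or.inr ?_⟩
  suffices h : ∃ w, pentagonRel m p w ∧ pentagonRel m q w by
    obtain ⟨w, h1, h2⟩ := h
    exact ⟨w, pentagonGraph_adj_group.2 h1, (pentagonGraph_adj_group.2 h2).symm⟩
  obtain ⟨i, x⟩ := p
  obtain ⟨j, y⟩ := q
  have hij : ∀ i j : ZMod 5, i = j ∨ i = j + 1 ∨ j = i + 1 ∨ j = i + 2 ∨ i = j + 2 := by decide
  rcases hij i j with rfl | rfl | rfl | rfl | rfl
  · exact ⟨.inl i, by simp [pentagonRel], by simp [pentagonRel]⟩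
  · exact ⟨.inl (j + 1), by simp [pentagonRel], by simp [pentagonRel]⟩
  · exact ⟨.inl (i + 1), by simp [pentagonRel], by simp [pentagonRel]⟩
  · exact ⟨.inr (.inr (i, x, y)), by simp [pentagonRel], by simp [pentagonRel]⟩
  · exact ⟨.inr (.inr (j, y, x)), by simp [pentagonRel], by simp [pentagonRel]⟩

theorem five_mul_mem_degenerateSizes {m D : ℕ} (h : 2 * m + 2 ≤ D) :
    5 * m ∈ degenerateSizes D := by
  classical
  refine ⟨PentagonVertex m, inferInstance, pentagonGraph m, inferInstance,
    pentagonGraph_isDegenerate, ?_, _, pentagonGraph_isClique, ?_⟩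
  · exact SimpleGraph.maxDegree_le_of_forall_degree_le _ _ fun v =>
      (pentagonGraph_degree_le v).trans h
  · simp [ZMod.card]

end PentagonConstruction

/-! ### Heavy vertices and the linear bound on cliques -/

section Reduction

variable {V : Type*} [Fintype V] [DecidableEq V] {G : SimpleGraph V} [DecidableRel G.Adj]

variable (G) in
/-- Outside `A`, the vertices with at least three neighbours in `A`. -/
def heavy (A : Finset V) : Finset V := {w | w ∉ A ∧ 3 ≤ degIn G A w}

theorem disjoint_heavy (A : Finset V) : Disjoint A (heavy G A) :=
  by
  exact disjoint_left.2 fun _ h h' => (mem_filter.1 h').2.1 h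

/-- Adding `w` to `T` in the edge count costs 4 and gains `2 * degIn G A w`, so it pays exactly from
three neighbours on. -/
theorem two_mul_sum_heavy_lt (hmad : mad G < 4) {A : Finset V} (hA : A.Nonempty) :
    2 * ∑ w ∈ heavy G A, (degIn G A w - 2) + ∑ u ∈ A, degIn G A u < 4 * #A := by
  have h := two_mul_sum_degIn_lt hmad hA (disjoint_heavy (G := G) A)
  have h2 : ∑ w ∈ heavy G A, degIn G A w = ∑ w ∈ heavy G A, (degIn G A w - 2) + 2 * #(heavy G A) := by
    rw [mul_comm 2, ← smul_eq_mul, ← sum_const, ← sum_add_distrib]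
    refine sum_congr rfl fun w hw => ?_
    have := (mem_filter.1 hw).2.2
    omega
  omega

theorem sum_eq_sum_add_sum_heavy {M : Type*} [AddCommMonoid M] (A : Finset V) (F : V → M)
    (hF : ∀ w ∉ A, degIn G A w < 3 → F w = 0) :
    ∑ w, F w = ∑ w ∈ A, F w + ∑ w ∈ heavy G A, F w := by
  rw [← sum_union (disjoint_heavy A)]
  refine (sum_subset (subset_univ _) fun w _ hw => ?_).symm
  rw [mem_union, not_or] at hw
  refine hF w hw.1 (not_le.1 fun h => hw.2 ?_)
  simp [heavy, hw.1, h]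

/-- Summing `card_le_sum_excess` over `A` counts each excess at most D times, and the excesses total
at most `4 * #A`. -/
theorem card_le_five_mul {D : ℕ} (hmad : mad G < 4) (hD : G.maxDegree ≤ D) {A : Finset V}
    (hA : (square G).IsClique (A : Set V)) : #A ≤ 5 * D + 1 := by
  rcases A.eq_empty_or_nonempty with rfl | hne
  · simp
  have h1 : #A * #A ≤ ∑ u ∈ A, (1 + D + ∑ w with G.Adj u w, excess G A w) := by
    rw [← smul_eq_mul]
    refine card_nsmul_le_sum _ _ _ fun u hu => (card_le_sum_excess hA hu).trans ?_
    rw [sum_add_distrib, sum_const, smul_eq_mul, mul_one]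
    have : #({w | G.Adj u w} : Finset V) ≤ D := degIn_le_of_maxDegree_le hD univ u
    omega
  have h2 : ∑ u ∈ A, ∑ w with G.Adj u w, excess G A w ≤ D * ∑ w, excess G A w := by
    rw [sum_sum_adj_eq, mul_sum]
    exact sum_le_sum fun w _ => Nat.mul_le_mul_right _ (degIn_le_of_maxDegree_le hD A w)
  have h3 : ∑ w, excess G A w ≤ 4 * #A := by
    rw [sum_eq_sum_add_sum_heavy (G := G) A _ (fun w hw h => by simp only [excess, hw]; grind)]
    have ha : ∑ w ∈ A, excess G A w ≤ ∑ w ∈ A, degIn G A w :=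
      sum_le_sum fun w hw => by simp [excess, hw]
    have hb : ∑ w ∈ heavy G A, excess G A w = ∑ w ∈ heavy G A, (degIn G A w - 2) :=
      sum_congr rfl fun w hw => by simp [excess, (mem_filter.1 hw).2.1]
    have := two_mul_sum_heavy_lt hmad hne
    omega
  rw [sum_add_distrib, sum_const, smul_eq_mul] at h1
  have h4 : #A * #A ≤ #A * (5 * D + 1) := by nlinarith
  exact Nat.le_of_mul_le_mul_left h4 hne.card_pos

/-! ### Discharging -/

variable (G) in
/-- The part of the edge count that `w` passes to each of its neighbours in `A`. -/
noncomputable def charge (A : Finset V) (w : V) : ℝ :=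
  if w ∈ A then 1 / 2 else if 3 ≤ degIn G A w then ((degIn G A w : ℝ) - 2) / degIn G A w else 0

theorem charge_nonneg (A : Finset V) (w : V) : 0 ≤ charge G A w := by
  unfold charge
  split_ifs with h1 h2
  · norm_num
  · have : (3 : ℝ) ≤ degIn G A w := by exact_mod_cast h2
    exact div_nonneg (by linarith) (by linarith)
  · rfl

/-- A heavy `w` hands out `degIn G A w - 2` in total and a vertex of `A` half its degree in `A`:
half the left side of `two_mul_sum_heavy_lt`. -/
theorem sum_charge_lt (hmad : mad G < 4) {A : Finset V} (hA : A.Nonempty) :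
    ∑ u ∈ A, ∑ w with G.Adj u w, charge G A w < 2 * #A := by
  rw [sum_sum_adj_eq, sum_eq_sum_add_sum_heavy (G := G) A _
    (fun w hw h => by simp [charge, hw, not_le.2 h])]
  have h1 : ∑ w ∈ A, (degIn G A w : ℝ) * charge G A w = (∑ w ∈ A, degIn G A w : ℕ) / 2 := by
    push_cast
    rw [sum_div]
    exact sum_congr rfl fun w hw => by simp [charge, hw, div_eq_mul_inv]
  have h2 : ∑ w ∈ heavy G A, (degIn G A w : ℝ) * charge G A w =
      (∑ w ∈ heavy G A, (degIn G A w - 2) : ℕ) := by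
    rw [Nat.cast_sum]
    refine sum_congr rfl fun w hw => ?_
    obtain ⟨hw1, hw2⟩ := (mem_filter.1 hw).2
    rw [charge, if_neg hw1, if_pos hw2, mul_div_cancel₀ _ (by positivity),
      Nat.cast_sub (by omega)]
    simp
  have h3 : (2 * (∑ w ∈ heavy G A, (degIn G A w - 2) : ℕ) + (∑ u ∈ A, degIn G A u : ℕ) : ℝ) <
      4 * #A := by exact_mod_cast two_mul_sum_heavy_lt hmad hA
  rw [h1, h2]
  linarith

/-- If the excesses of a family with small or nearly full charges add up to at least `3D/2`, then
its charges add up to nearly `2`, and to a third more if it has three nontrivial members. -/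
theorem le_sum_charge {ι : Type*} [DecidableEq ι] {N : Finset ι} {y c : ι → ℝ} {D : ℝ}
    (hD : 18 ≤ D) (hc : ∀ i ∈ N, 0 ≤ c i) (hyD : ∀ i ∈ N, y i ≤ D)
    (hbig : ∀ i ∈ N, D / 6 ≤ y i → 1 - 12 / D ≤ c i)
    (hsmall : ∀ i ∈ N, y i < D / 6 → 3 * y i / D ≤ c i) (hy : 3 * D / 2 ≤ ∑ i ∈ N, y i) :
    2 - 24 / D ≤ ∑ i ∈ N, c i ∧
      (3 ≤ #{i ∈ N | 1 / 3 ≤ c i} → 7 / 3 - 24 / D ≤ ∑ i ∈ N, c i) := by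
  have hD0 : 0 < D := by linarith
  -- This makes three nearly full charges, 3 − 36/D, reach 7/3 − 24/D.
  have hD12 : 12 / D ≤ 2 / 3 := by rw [div_le_iff₀ hD0]; linarith
  have hD24 : 24 / D = 2 * (12 / D) := by ring
  have hD12' : 0 ≤ 12 / D := by positivity
  set B : Finset ι := {i ∈ N | D / 6 ≤ y i} with hB
  set R : Finset ι := {i ∈ N | ¬ D / 6 ≤ y i} with hR
  have hsplit : ∀ F : ι → ℝ, ∑ i ∈ N, F i = ∑ i ∈ B, F i + ∑ i ∈ R, F i :=
    fun F => (sum_filter_add_sum_filter_not N _ F).symm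
  have hBc : #B * (1 - 12 / D) ≤ ∑ i ∈ B, c i := by
    rw [← nsmul_eq_mul]
    exact card_nsmul_le_sum _ _ _ fun i hi => hbig i (mem_filter.1 hi).1 (mem_filter.1 hi).2
  have hRc0 : 0 ≤ ∑ i ∈ R, c i := sum_nonneg fun i hi => hc i (mem_filter.1 hi).1
  have hRc : 3 * (∑ i ∈ R, y i) / D ≤ ∑ i ∈ R, c i := by
    rw [mul_sum, sum_div]
    exact sum_le_sum fun i hi => hsmall i (mem_filter.1 hi).1 (not_le.1 (mem_filter.1 hi).2)
  have hBy : ∑ i ∈ B, y i ≤ #B * D := by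
    rw [← nsmul_eq_mul]
    exact sum_le_card_nsmul _ _ _ fun i hi => hyD i (mem_filter.1 hi).1
  rw [hsplit y] at hy
  rw [hsplit c]
  -- With at most one big member, the small ones carry at least D/2 and at rate 3/D earn at least
  -- 3/2, more than a second big member would.
  rcases lt_trichotomy #B 2 with h | h | h
  · have h1 : (#B : ℝ) ≤ 1 := by exact_mod_cast Nat.lt_succ_iff.1 h
    have h2 : (3 / 2 - #B) * D ≤ ∑ i ∈ R, y i := by linarith
    have h3 : 3 * (3 / 2 - #B) ≤ ∑ i ∈ R, c i := by
      refine le_trans ?_ hRc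
      rw [le_div_iff₀ hD0]
      linarith
    have h4 : (0 : ℝ) ≤ #B := by positivity
    have h5 : 7 / 3 - 24 / D ≤ ∑ i ∈ B, c i + ∑ i ∈ R, c i := by nlinarith
    exact ⟨by linarith, fun _ => h5⟩
  · rw [h] at hBc
    push_cast at hBc
    refine ⟨by linarith, fun h3 => ?_⟩
    obtain ⟨i, hi, hiB⟩ := exists_mem_notMem_of_card_lt_card
      (s := B) (t := {i ∈ N | 1 / 3 ≤ c i}) (by omega)
    rw [mem_filter] at hi
    have hiR : i ∈ R := by
      simp only [hB, mem_filter, not_and] at hiB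
      simp only [hR, mem_filter]
      exact ⟨hi.1, hiB hi.1⟩
    have := single_le_sum (f := c) (s := R) (fun j hj => hc j (mem_filter.1 hj).1) hiR
    linarith [hi.2]
  · have h1 : (3 : ℝ) ≤ #B := by exact_mod_cast h
    have h5 : 7 / 3 - 24 / D ≤ ∑ i ∈ B, c i + ∑ i ∈ R, c i := by nlinarith
    exact ⟨by linarith, fun _ => h5⟩

variable (G) in
/-- The vertices of `A` with at least three neighbours that are in `A` or have at least three
neighbours in `A`. -/
def crowded (A : Finset V) : Finset V :=
  {u ∈ A | 3 ≤ #{w | G.Adj u w ∧ (w ∈ A ∨ 3 ≤ degIn G A w)}}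

theorem crowded_subset (A : Finset V) : crowded G A ⊆ A := filter_subset _ _

variable {D : ℕ} {A : Finset V}

theorem excess_le_of_maxDegree_le (hD : G.maxDegree ≤ D) (w : V) : excess G A w ≤ D := by
  have := degIn_le_of_maxDegree_le hD A w
  unfold excess
  split_ifs <;> omega

theorem excess_div_le_charge (hD : G.maxDegree ≤ D) (hsmall : ∀ v ∈ A, 6 * degIn G A v < D)
    (w : V) : (excess G A w : ℝ) / D ≤ charge G A w := by
  have hd := degIn_le_of_maxDegree_le hD A w
  unfold excess charge
  split_ifs with h1 h2
  · have h3 := hsmall w h1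
    rw [div_le_div_iff₀ (by exact_mod_cast (by omega)) (by norm_num)]
    exact_mod_cast (by omega : (degIn G A w - 1) * 2 ≤ 1 * D)
  · rw [Nat.cast_sub (by omega)]
    have : (3 : ℝ) ≤ degIn G A w := by exact_mod_cast h2
    push_cast
    gcongr
    linarith
  · simp [show degIn G A w - 2 = 0 by omega]

theorem sum_excess_ge (hD : G.maxDegree ≤ D) (hA : (square G).IsClique (A : Set V)) {u : V}
    (hu : u ∈ A) : (#A : ℝ) - 1 - D ≤ ∑ w with G.Adj u w, (excess G A w : ℝ) := by
  have h := card_le_sum_excess hA hu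
  rw [sum_add_distrib, sum_const, smul_eq_mul, mul_one] at h
  have h2 : #({w | G.Adj u w} : Finset V) ≤ D := degIn_le_of_maxDegree_le hD univ u
  have h3 : #A ≤ 1 + D + ∑ w with G.Adj u w, excess G A w := by omega
  have h4 : (#A : ℝ) ≤ 1 + D + ∑ w with G.Adj u w, (excess G A w : ℝ) := by exact_mod_cast h3
  linarith

/-- Charge dominates excess divided by D and averages below 2. The bound fixes the constant in
`card_crowded_le`. -/
theorem card_le_three_mul (hmad : mad G < 4) (hD : G.maxDegree ≤ D)
    (hA : (square G).IsClique (A : Set V)) (hsmall : ∀ v ∈ A, 6 * degIn G A v < D) (hD0 : 0 < D) :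
    (#A : ℝ) ≤ 3 * D + 1 := by
  rcases A.eq_empty_or_nonempty with rfl | hne
  · simp; positivity
  have hD0' : (0 : ℝ) < D := by exact_mod_cast hD0
  have h1 : #A * (((#A : ℝ) - 1 - D) / D) ≤ ∑ u ∈ A, ∑ w with G.Adj u w, charge G A w := by
    rw [← nsmul_eq_mul]
    refine card_nsmul_le_sum _ _ _ fun u hu => ?_
    refine (div_le_div_of_nonneg_right (sum_excess_ge hD hA hu) hD0'.le).trans ?_
    rw [sum_div]
    exact sum_le_sum fun w _ => excess_div_le_charge hD hsmall w
  have h2 := h1.trans_lt (sum_charge_lt hmad hne)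
  have hA0 : (0 : ℝ) < #A := by exact_mod_cast hne.card_pos
  rw [mul_comm 2] at h2
  have h3 := lt_of_mul_lt_mul_left h2 hA0.le
  rw [div_lt_iff₀ hD0'] at h3
  linarith

theorem le_sum_charge_neighbors (hD : G.maxDegree ≤ D) (hD18 : 18 ≤ D)
    (hA : (square G).IsClique (A : Set V)) (hsmall : ∀ v ∈ A, 6 * degIn G A v < D)
    (hcard : 5 * D + 2 ≤ 2 * #A) {u : V} (hu : u ∈ A) :
    2 - 24 / (D : ℝ) ≤ ∑ w with G.Adj u w, charge G A w ∧
      (u ∈ crowded G A → 7 / 3 - 24 / (D : ℝ) ≤ ∑ w with G.Adj u w, charge G A w) := by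
  have hD18' : (18 : ℝ) ≤ D := by exact_mod_cast hD18
  have hD0 : (0 : ℝ) < D := by linarith
  have key := le_sum_charge (N := ({w | G.Adj u w} : Finset V))
    (y := fun w => (excess G A w : ℝ)) (c := charge G A) hD18'
    (fun w _ => charge_nonneg A w)
    (fun w _ => by exact_mod_cast excess_le_of_maxDegree_le hD w)
    (fun w _ hw => ?_) (fun w _ hw => ?_) ?_
  · refine ⟨key.1, fun hc => key.2 ((mem_filter.1 hc).2.trans (card_le_card fun w hw => ?_))⟩
    simp only [mem_filter, mem_univ, true_and] at hw ⊢
    refine ⟨hw.1, ?_⟩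
    unfold charge
    split_ifs with h1 h2
    · norm_num
    · have : (3 : ℝ) ≤ degIn G A w := by exact_mod_cast h2
      rw [le_div_iff₀ (by linarith)]
      linarith
    · exact (hw.2.elim h1 h2).elim
  · have hw' : D ≤ 6 * excess G A w := by
      rw [div_le_iff₀ (by norm_num)] at hw
      exact_mod_cast (by linarith : (D : ℝ) ≤ 6 * excess G A w)
    unfold excess at hw'
    unfold charge
    split_ifs at hw' ⊢ with h1 h2
    · have := hsmall w h1
      omega
    · have h3 : (D : ℝ) ≤ 6 * (degIn G A w : ℝ) := by
        exact_mod_cast (by omega : D ≤ 6 * degIn G A w)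
      have h4 : (0 : ℝ) < degIn G A w := by linarith
      rw [sub_div, div_self h4.ne']
      have : 2 / (degIn G A w : ℝ) ≤ 12 / D := by
        rw [div_le_div_iff₀ h4 hD0]
        linarith
      linarith
    · omega
  · have hw' : 6 * excess G A w < D := by
      rw [lt_div_iff₀ (by norm_num)] at hw
      exact_mod_cast (by linarith : 6 * (excess G A w : ℝ) < D)
    rw [div_le_iff₀ hD0]
    unfold excess at hw' ⊢
    unfold charge
    split_ifs at hw' ⊢ with h1 h2
    · have : (6 * (degIn G A w - 1 : ℕ) : ℝ) < D := by exact_mod_cast hw'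
      linarith
    · rw [Nat.cast_sub (by omega)] at *
      have h3 : (3 : ℝ) ≤ degIn G A w := by exact_mod_cast h2
      have h4 : 6 * ((degIn G A w : ℝ) - 2) < D := by
        have : (6 * (degIn G A w - 2 : ℕ) : ℝ) < D := by exact_mod_cast hw'
        rwa [Nat.cast_sub (by omega)] at this
      push_cast
      rw [div_mul_eq_mul_div, le_div_iff₀ (by linarith)]
      -- From degIn < D/6 + 2 and D ≥ 12; it turns (d − 2)/d into at least 3(d − 2)/D.
      have h5 : 3 * (degIn G A w : ℝ) ≤ D := by linarith
      nlinarith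
    · simp [show degIn G A w - 2 = 0 by omega]
  · refine le_trans ?_ (sum_excess_ge hD hA hu)
    have : (5 * D + 2 : ℝ) ≤ 2 * #A := by exact_mod_cast hcard
    linarith

/-- The average below 2 leaves a slack of 24/D per vertex, and each crowded vertex uses 1/3 of it.
So there are fewer than 72|A|/D ≤ 216 + 72/D of them, which is below 217 as D > 72. -/
theorem card_crowded_le (hmad : mad G < 4) (hD : G.maxDegree ≤ D) (hD72 : 72 < D)
    (hA : (square G).IsClique (A : Set V)) (hsmall : ∀ v ∈ A, 6 * degIn G A v < D)
    (hcard : 5 * D + 2 ≤ 2 * #A) : #(crowded G A) ≤ 216 := by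
  have hne : A.Nonempty := card_pos.1 (by omega)
  have hD0 : (0 : ℝ) < D := by exact_mod_cast (by omega : 0 < D)
  have h1 : ∑ u ∈ A, ((2 - 24 / (D : ℝ)) + if u ∈ crowded G A then 1 / 3 else 0) ≤
      ∑ u ∈ A, ∑ w with G.Adj u w, charge G A w := by
    refine sum_le_sum fun u hu => ?_
    have h := le_sum_charge_neighbors hD (by omega) hA hsmall hcard hu
    split_ifs with hc
    · linarith [h.2 hc]
    · linarith [h.1]
  rw [sum_add_distrib, ← sum_filter, sum_const, sum_const, nsmul_eq_mul, nsmul_eq_mul,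
    filter_mem_eq_inter, inter_eq_right.2 (crowded_subset A)] at h1
  have h2 := h1.trans_lt (sum_charge_lt hmad hne)
  have h3 : (#(crowded G A) : ℝ) < 72 * #A / D := by
    have : (#A : ℝ) * (24 / D) = (72 * #A / D) / 3 := by ring
    linarith
  rw [lt_div_iff₀ hD0] at h3
  have h4 := card_le_three_mul hmad hD hA hsmall (by omega)
  have h5 : (72 : ℝ) < D := by exact_mod_cast hD72
  have h6 : (#(crowded G A) : ℝ) * D < 217 * D := by linarith
  have h7 : (#(crowded G A) : ℝ) < 217 := lt_of_mul_lt_mul_right h6 hD0.le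
  have : #(crowded G A) < 217 := by exact_mod_cast h7
  omega

/-! ### The 2-degenerate spanning subgraph -/

variable (G) in
/-- The spanning subgraph of the edges with an end in `B`. -/
def touching (B : Finset V) : SimpleGraph V where
  Adj u v := G.Adj u v ∧ (u ∈ B ∨ v ∈ B)
  symm := ⟨fun _ _ h => ⟨h.1.symm, h.2.symm⟩⟩
  loopless := ⟨fun u h => G.loopless.irrefl u h.1⟩

/-- Every edge of a path of length at most 2 between vertices of `B` has an end in `B`. -/
theorem touching_isClique {B : Finset V} (hB : (square G).IsClique (B : Set V)) :
    (square (touching G B)).IsClique (B : Set V) := by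
  intro u hu v hv huv
  obtain ⟨-, h⟩ := square_adj_iff.1 (hB hu hv huv)
  refine square_adj_iff.2 ⟨huv, ?_⟩
  rcases h with h | ⟨w, h1, h2⟩
  · exact Or.inl ⟨h, Or.inl hu⟩
  · exact Or.inr ⟨w, ⟨h1, Or.inl hu⟩, ⟨h2, Or.inr hv⟩⟩

/-- Vertices outside `A` with at most two neighbours in `A` can go first. After that, an uncrowded
vertex of `A` sees at most two vertices, and every edge has such an end. -/
theorem touching_isDegenerate (A : Finset V) :
    IsDegenerate 2 (touching G (A \ crowded G A)) := by
  intro H hH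
  by_cases h1 : ∃ v ∈ H.verts, v ∉ A ∧ degIn G A v < 3
  · obtain ⟨v, hv, hvA, hd⟩ := h1
    refine ⟨v, hv, ?_⟩
    have hsub : H.neighborSet v ⊆ (({u ∈ A | G.Adj v u} : Finset V) : Set V) := by
      intro w hw
      obtain ⟨ha, hb⟩ := H.adj_sub hw
      simp only [mem_sdiff] at hb
      simpa [ha] using hb.elim (fun h => (hvA h.1).elim) And.left
    refine (Set.encard_le_encard hsub).trans ?_
    rw [Set.encard_coe_eq_coe_finsetCard]
    exact_mod_cast Nat.lt_succ_iff.1 hd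
  push Not at h1
  by_cases h2 : ∃ v ∈ H.verts, v ∈ A \ crowded G A
  · obtain ⟨v, hv, hvB⟩ := h2
    refine ⟨v, hv, ?_⟩
    rw [mem_sdiff] at hvB
    have hsub : H.neighborSet v ⊆
        (({w | G.Adj v w ∧ (w ∈ A ∨ 3 ≤ degIn G A w)} : Finset V) : Set V) := by
      intro w hw
      have hwA := h1 w (H.edge_vert (H.adj_symm hw))
      simp only [coe_filter, mem_univ, true_and, Set.mem_ofPred_eq]
      exact ⟨(H.adj_sub hw).1, or_iff_not_imp_left.2 hwA⟩
    refine (Set.encard_le_encard hsub).trans ?_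
    rw [Set.encard_coe_eq_coe_finsetCard]
    have : ¬ 3 ≤ #({w | G.Adj v w ∧ (w ∈ A ∨ 3 ≤ degIn G A w)} : Finset V) := fun h =>
      hvB.2 (mem_filter.2 ⟨hvB.1, h⟩)
    exact_mod_cast (by omega : _ ≤ 2)
  · push Not at h2
    obtain ⟨v, hv⟩ := hH
    refine ⟨v, hv, ?_⟩
    have : H.neighborSet v = ∅ := by
      refine Set.eq_empty_of_forall_notMem fun w hw => ?_
      exact (H.adj_sub hw).2.elim (h2 v hv) (h2 w (H.edge_vert (H.adj_symm hw)))
    simp [this]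

theorem maxDegree_touching_le (B : Finset V) [DecidableRel (touching G B).Adj]
    (hD : G.maxDegree ≤ D) : (touching G B).maxDegree ≤ D := by
  refine SimpleGraph.maxDegree_le_of_forall_degree_le _ _ fun v => ?_
  refine le_trans ?_ (degIn_le_of_maxDegree_le hD univ v)
  rw [← degIn_univ_eq_degree]
  exact card_le_card (monotone_filter_right _ fun w _ h => h.1)

/-- A large clique in the square of a graph with `mad G < 4` loses at most `336` vertices in
passing to a 2-degenerate spanning subgraph. -/
theorem exists_isDegenerate_touching (hmad : mad G < 4) (hD : G.maxDegree ≤ D) (hD72 : 72 < D)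
    {S : Finset V} (hS : (square G).IsClique (S : Set V)) (hcard : 5 * D + 242 ≤ 2 * #S) :
    ∃ B : Finset V, IsDegenerate 2 (touching G B) ∧
      (square (touching G B)).IsClique (B : Set V) ∧ #S ≤ #B + 336 := by
  set R : Finset V := {v ∈ S | D ≤ 6 * degIn G S v} with hR
  have hR120 : #R ≤ 120 := by
    -- The degrees inside `S` sum to less than 4|S| ≤ 4(5D + 1), so 121 such vertices would force
    -- 121D < 120D + 24.
    have h1 : #R * D ≤ 6 * ∑ v ∈ S, degIn G S v := by
      rw [← smul_eq_mul, mul_sum]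
      exact (card_nsmul_le_sum _ _ _ fun v hv => (mem_filter.1 hv).2).trans
        (sum_le_sum_of_subset (filter_subset _ _))
    have h2 := two_mul_sum_heavy_lt hmad (card_pos.1 (by omega : 0 < #S))
    have h3 := card_le_five_mul hmad hD hS
    by_contra! h
    have : 121 * D ≤ #R * D := Nat.mul_le_mul_right _ h
    omega
  have hRS : #(S \ R) = #S - #R := card_sdiff_of_subset (filter_subset _ _)
  have hA : (square G).IsClique ((S \ R : Finset V) : Set V) :=
    hS.subset (coe_subset.2 sdiff_subset)
  have hsmall : ∀ v ∈ S \ R, 6 * degIn G (S \ R) v < D := by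
    intro v hv
    have h := degIn_mono (G := G) (sdiff_subset : S \ R ⊆ S) v
    simp only [hR, mem_sdiff, mem_filter, not_and, not_le] at hv
    have := hv.2 hv.1
    omega
  -- The 242 in the hypothesis is 2 + 2 · 120, paying for the removal of `R`.
  have h216 := card_crowded_le hmad hD hD72 hA hsmall (by omega)
  refine ⟨(S \ R) \ crowded G (S \ R), touching_isDegenerate _,
    touching_isClique (hA.subset (coe_subset.2 sdiff_subset)), ?_⟩
  rw [card_sdiff_of_subset (crowded_subset _)]
  omega

end Reduction

end SquareClique

theorem theorem6 (D : ℕ) (hD : 0 < D) :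
    IsGreatest (SquareClique.degenerateSizes D) (SquareClique.f D) ∧
    IsGreatest (SquareClique.madSizes D) (SquareClique.g D) ∧
    (∃ (V : Type) (_ : Fintype V) (G : SimpleGraph V) (_ : DecidableRel G.Adj),
      SquareClique.IsDegenerate 2 G ∧ G.maxDegree ≤ D ∧
      ∃ S : Finset V, (SquareClique.square G).IsClique (S : Set V) ∧
        (SquareClique.g D : ℤ) - 460 ≤ (S.card : ℤ)) ∧
    (0 ≤ (SquareClique.g D : ℤ) - (SquareClique.f D : ℤ) ∧
      (SquareClique.g D : ℤ) - (SquareClique.f D : ℤ) ≤ 460) := by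
  classical
  have hf := SquareClique.isGreatest_f D
  have hg := SquareClique.isGreatest_g D
  have hfg := hg.2 (SquareClique.degenerateSizes_subset_madSizes D hf.1)
  have hgf : SquareClique.g D ≤ SquareClique.f D + 460 := by
    by_contra! hlt
    obtain ⟨V, _, G, _, hmad, hΔ, S, hS⟩ := hg.1
    have h5 := SquareClique.card_le_five_mul hmad hΔ hS.isClique
    -- Since 460 < |S| ≤ 5D + 1, the truncated D − 2 is harmless. Now f(D) ≥ (5D − 15)/2, and |S| >
    -- f(D) + 460 yields both D > 72 and the size needed for the reduction, which loses only 336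
    -- vertices.
    have hm := hf.2 (SquareClique.five_mul_mem_degenerateSizes
      (show 2 * ((D - 2) / 2) + 2 ≤ D by have := hS.card_eq; omega))
    have hcard := hS.card_eq
    obtain ⟨B, hB1, hB2, hB3⟩ :=
      SquareClique.exists_isDegenerate_touching hmad hΔ (by omega) hS.isClique (by omega)
    have := hf.2 ⟨V, _, SquareClique.touching G B, inferInstance, hB1,
      SquareClique.maxDegree_touching_le B hΔ, B, hB2, rfl⟩
    omega
  refine ⟨hf, hg, ?_, by omega, by omega⟩
  obtain ⟨V, _, G, _, h1, h2, S, hS⟩ := hf.1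
  exact ⟨V, _, G, _, h1, h2, S, hS.isClique, by have := hS.card_eq; omega⟩
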